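/- Consider the formal series $$K(p,q)=(p^{1/2}-p^{-1/2})\prod_{m\ge 1}\frac{(1-pq^m)(1-p^{-1}q^m)}{(1-q^m)^2},$$ $$\wp(p,q)=\frac1{12}+\frac{p}{(1-p)^2}+\sum_{d\ge 1}\sum_{m\mid d}m\,(p^m-2+p^{-m})\,q^d ,$$ where $p/(1-p)^2$ is expanded in the region $|p|<1$. (With $p=e^{2\pi i z}$ and $q=e^{2\pi i\tau}$ these are the functions $K(z,\tau)$ and $\wp(z,\tau)$, and $K(p^2,q^2)$ is $K(2z,2\tau)$.) For $d\ge 0$ let $f_d(p),g_d(p)\in\mathbb{Q}((p))$ be the Laurent series determined by $$\sum_{d\ge 0}f_d(p)\,q^d=K(p,q)^2,\qquad \sum_{d\ge 0}g_d(p)\,q^d=\frac32\,K(p,q)^4\,\wp(p,q)+\frac38\,K(p^2,q^2)^2 .$$ These Laurent series exist and are unique, and for all $d\ge 0$ $$g_d(p)=\begin{cases} f_{2d}(p) & \text{if } d \text{ is odd},\\[2pt] f_{2d}(p)+\frac12\,f_{d/2}(p^2) & \text{if } d\text{ is even}.\end{cases}$$ -/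

import Mathlib

noncomputable section

namespace AbelianThreefold

open PowerSeries

/-- The generator `x` of the field `ℚ((x))` of formal Laurent series. -/
def gen : LaurentSeries ℚ := HahnSeries.single 1 1

/-- The substitution `F(x) ↦ F(x²)` on formal Laurent series `ℚ((x))`. It is used in two ways:
as the operation `F(p) ↦ F(p²)`, and, with `s = p^{1/2}`, as the inclusion of `ℚ((p))` into
`ℚ((s))` sending `p` to `s²`. -/
def substSq : LaurentSeries ℚ →+* LaurentSeries ℚ :=
  HahnSeries.embDomainRingHom (AddMonoidHom.mulLeft (2 : ℤ))
    (fun a b h => by simpa using h) (fun a b => by simp)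

/-- `substSq` does what its name says: the coefficient of `x^(2n)` in `F(x²)` is that of `x^n`
in `F(x)`. -/
theorem coeff_substSq_two_mul (F : LaurentSeries ℚ) (n : ℤ) :
    (substSq F).coeff (2 * n) = F.coeff n :=
  HahnSeries.embDomain_coeff (f := ⟨⟨AddMonoidHom.mulLeft (2 : ℤ), _⟩, _⟩) (a := n)

theorem coeff_substSq_odd (F : LaurentSeries ℚ) (n : ℤ) :
    (substSq F).coeff (2 * n + 1) = 0 := by
  refine HahnSeries.embDomain_of_notMem_range (f := ⟨⟨AddMonoidHom.mulLeft (2 : ℤ), _⟩, _⟩) ?_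
  rintro ⟨a, ha⟩
  have h : 2 * a = 2 * n + 1 := ha
  omega

/-- The inclusion `ℚ((p))[[q]] → ℚ((s))[[q]]`, where `s = p^{1/2}`. -/
def inHalf : PowerSeries (LaurentSeries ℚ) →+* PowerSeries (LaurentSeries ℚ) :=
  PowerSeries.map substSq

/-- The substitution `F(p, q) ↦ F(p², q²)`; in terms of `s = p^{1/2}` it is
`s ↦ s²`, `q ↦ q²`. -/
def doubleVars (F : PowerSeries (LaurentSeries ℚ)) : PowerSeries (LaurentSeries ℚ) :=
  PowerSeries.expand 2 two_ne_zero (PowerSeries.map substSq F)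

/-- The factor `(1 - p q^m) (1 - p⁻¹ q^m) / (1 - q^m)²` in `ℚ((s))[[q]]`, with `p = s²`. -/
def thetaFactor (m : ℕ) : PowerSeries (LaurentSeries ℚ) :=
  (1 - C (gen ^ 2) * X ^ m) * (1 - C ((gen ^ 2)⁻¹) * X ^ m) * ((1 - X ^ m) ^ 2)⁻¹

/-- The infinite product `∏_{m ≥ 1} (1 - p q^m) (1 - p⁻¹ q^m) / (1 - q^m)²`. Its coefficient of
`q^d` is that of the product over `m ≤ d`, because the later factors are `1` modulo `q^(d+1)`;
see `coeff_thetaProd`. -/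
def thetaProd : PowerSeries (LaurentSeries ℚ) :=
  PowerSeries.mk fun d => coeff d (∏ m ∈ Finset.Icc 1 d, thetaFactor m)

theorem thetaFactor_sub_one_dvd {m : ℕ} (hm : m ≠ 0) :
    (X : PowerSeries (LaurentSeries ℚ)) ^ m ∣ thetaFactor m - 1 := by
  have hc : constantCoeff ((1 - X ^ m : PowerSeries (LaurentSeries ℚ)) ^ 2) ≠ 0 := by
    simp [hm]
  have h1 : ((1 - X ^ m : PowerSeries (LaurentSeries ℚ)) ^ 2)
      * ((1 - X ^ m) ^ 2)⁻¹ = 1 := PowerSeries.mul_inv_cancel _ hc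
  refine ⟨(C (gen ^ 2) * C ((gen ^ 2)⁻¹) * X ^ m - C (gen ^ 2) - C ((gen ^ 2)⁻¹) + 2 - X ^ m)
    * ((1 - X ^ m) ^ 2)⁻¹, ?_⟩
  unfold thetaFactor
  linear_combination h1

/-- For every `N ≥ d`, the infinite product and its truncation at `N` have the same coefficient
of `q^d`. -/
theorem coeff_thetaProd {d N : ℕ} (h : d ≤ N) :
    coeff d thetaProd = coeff d (∏ m ∈ Finset.Icc 1 N, thetaFactor m) := by
  induction N, h using Nat.le_induction with
  | base => simp [thetaProd]
  | succ N hN ih =>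
    rw [ih, Finset.prod_Icc_succ_top (by omega)]
    obtain ⟨c, hc⟩ := thetaFactor_sub_one_dvd (Nat.succ_ne_zero N)
    have : thetaFactor (N + 1) = 1 + X ^ (N + 1) * c := by
      rw [← hc]; ring
    rw [this, mul_add, mul_one, map_add, mul_left_comm, PowerSeries.coeff_X_pow_mul',
      if_neg (by omega), add_zero]

/-- The theta function
`K(p, q) = (p^{1/2} - p^{-1/2}) ∏_{m ≥ 1} (1 - p q^m) (1 - p⁻¹ q^m) / (1 - q^m)²`
as an element of `ℚ((s))[[q]]`, with `s = p^{1/2}`. -/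
def K : PowerSeries (LaurentSeries ℚ) := C (gen - gen⁻¹) * thetaProd

/-- The Weierstrass function
`℘(p, q) = 1/12 + p / (1 - p)² + ∑_{d ≥ 1} ∑_{m ∣ d} m (p^m - 2 + p^{-m}) q^d`
as an element of `ℚ((p))[[q]]`; in particular `p / (1 - p)²` is expanded at `p = 0`. -/
def weierstrassP : PowerSeries (LaurentSeries ℚ) :=
  PowerSeries.mk fun d =>
    if d = 0 then 1 / 12 + gen / (1 - gen) ^ 2
    else ∑ m ∈ d.divisors, (m : LaurentSeries ℚ) * (gen ^ m - 2 + (gen ^ m)⁻¹)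

/-- `f = (f_d)` is the sequence of coefficients of `K(p, q)²`:
`∑_d f_d(p) q^d = K(p, q)²`. -/
def IsCoeffsOne (f : ℕ → LaurentSeries ℚ) : Prop :=
  inHalf (PowerSeries.mk f) = K ^ 2

/-- `g = (g_d)` is the sequence of coefficients of the second series:
`∑_d g_d(p) q^d = (3/2) K(p, q)⁴ ℘(p, q) + (3/8) K(p², q²)²`. -/
def IsCoeffsTwo (g : ℕ → LaurentSeries ℚ) : Prop :=
  inHalf (PowerSeries.mk g) =
    (3 / 2 : ℚ) • (K ^ 4 * inHalf weierstrassP) + (3 / 8 : ℚ) • (doubleVars K) ^ 2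

end AbelianThreefold

end

noncomputable section

namespace AbelianThreefold

open PowerSeries

/-! ### Descent from `ℚ((s))` to `ℚ((p))` -/

/-! Everything descends to `phi`, the series K² in ℚ((p))[[q]], and the claim becomes `defect` = 0,
that is, 12 φ²℘ = φ(p², q²) + 8 ∑ f_{2d} q^d.

All three terms are even theta functions of index 2: after multiplication by p² each is invariant
under p ↦ q/p (`isQuasiPeriodic_defect`). To make this substitution formal, put a = p and b = q/p;
in ℚ[[a]][[b]] it is the exchange of the two variables. Modularity in τ plays no role.

Such a function is determined by its expansion to second order in Y = p - 2 + p⁻¹. Invariance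
equates the coefficient of p^l q^n, for l ≤ -3, with one at a lower power of q, or makes it zero. A
nonzero polynomial in Y divisible by Y³ has a nonzero coefficient at some p^l with l ≤ -3. Induction
on n then gives `eq_zero_of_isQuasiPeriodic`.

It remains to see that `defect` vanishes modulo Y³ (`exists_defect_eq`). Each factor of the product
is 1 - Y q^m/(1 - q^m)², so φ = Y - 2 Y² S + O(Y³) with S = ∑ σ(d) q^d. Moreover Y℘ = 1 + Y/12 +
O(Y²), and p ↦ p² sends Y to Y² + 4Y. The coefficient of Y is 12 - 4 - 8 = 0. That of Y² is a
multiple of ∑ σ(2d) q^d + 2 S(q²) - 3 S, which is zero by the Hecke relation at 2 for σ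
(`sigma_two_mul_add`). -/

theorem gen_ne_zero : gen ≠ 0 := by
  simp [gen]

theorem one_sub_gen_ne_zero : 1 - gen ≠ 0 := fun h => by
  have h1 := congrArg (fun F : LaurentSeries ℚ => F.coeff 0) h
  simp [gen] at h1

theorem gen_zpow (l : ℤ) : gen ^ l = HahnSeries.single l 1 := by
  exact (RatFunc.single_zpow l).symm

theorem coeff_gen_zpow_mul (F : LaurentSeries ℚ) (k l : ℤ) :
    (gen ^ k * F).coeff l = F.coeff (l - k) := by
  rw [gen_zpow, HahnSeries.coeff_single_mul, one_mul]

theorem coeff_gen_mul (F : LaurentSeries ℚ) (l : ℤ) :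
    (gen * F).coeff l = F.coeff (l - 1) := by
  simpa using coeff_gen_zpow_mul F 1 l

theorem coeff_gen_inv_mul (F : LaurentSeries ℚ) (l : ℤ) :
    (gen⁻¹ * F).coeff l = F.coeff (l + 1) := by
  simpa using coeff_gen_zpow_mul F (-1) l

theorem substSq_gen : substSq gen = gen ^ 2 := by
  have h : (gen ^ 2 : LaurentSeries ℚ) = HahnSeries.single 2 1 := by
    simpa using gen_zpow 2
  rw [h]
  exact HahnSeries.embDomain_single.trans rfl

theorem substSq_injective : Function.Injective substSq := substSq.injective

theorem inHalf_injective : Function.Injective inHalf := by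
  intro A B h
  ext1 n
  apply substSq_injective
  simpa [inHalf] using congrArg (coeff n) h

theorem isUnit_one_sub {R : Type*} [CommRing R] {h : PowerSeries R}
    (hh : constantCoeff h = 0) : IsUnit (1 - h) := by
  rw [PowerSeries.isUnit_iff_constantCoeff]
  simp [hh]

theorem map_inv_of_isUnit {k k' : Type*} [Field k] [Field k'] (f : PowerSeries k →+* PowerSeries k')
    {u : PowerSeries k} (hu : IsUnit u) : f u⁻¹ = (f u)⁻¹ := by
  have h1 : u * u⁻¹ = 1 := PowerSeries.mul_inv_cancel _ (by
    rw [PowerSeries.isUnit_iff_constantCoeff] at hu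
    exact hu.ne_zero)
  have h2 : constantCoeff (f u) ≠ 0 := by
    have := hu.map f
    rw [PowerSeries.isUnit_iff_constantCoeff] at this
    exact this.ne_zero
  rw [PowerSeries.eq_inv_iff_mul_eq_one h2, ← map_mul, mul_comm, h1, map_one]

theorem isUnit_one_sub_X_pow (R : Type*) [CommRing R] {m : ℕ} (hm : m ≠ 0) :
    IsUnit ((1 - X ^ m : PowerSeries R) ^ 2) :=
  (isUnit_one_sub (by simp [hm])).pow 2

/-- The factor `(1 - p q^m) (1 - p⁻¹ q^m) / (1 - q^m)²` in `ℚ((p))[[q]]`. -/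
def baseFactor (m : ℕ) : PowerSeries (LaurentSeries ℚ) :=
  (1 - C gen * X ^ m) * (1 - C gen⁻¹ * X ^ m) * ((1 - X ^ m) ^ 2)⁻¹

/-- The product `∏_{m ≥ 1} (1 - p q^m) (1 - p⁻¹ q^m) / (1 - q^m)²` in `ℚ((p))[[q]]`. -/
def baseProd : PowerSeries (LaurentSeries ℚ) :=
  PowerSeries.mk fun d => coeff d (∏ m ∈ Finset.Icc 1 d, baseFactor m)

theorem inHalf_baseFactor {m : ℕ} (hm : m ≠ 0) : inHalf (baseFactor m) = thetaFactor m := by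
  unfold baseFactor thetaFactor
  rw [map_mul, map_inv_of_isUnit _ (isUnit_one_sub_X_pow _ hm)]
  simp [inHalf, substSq_gen]

theorem inHalf_prod_baseFactor (N : ℕ) :
    inHalf (∏ m ∈ Finset.Icc 1 N, baseFactor m) = ∏ m ∈ Finset.Icc 1 N, thetaFactor m := by
  rw [map_prod]
  refine Finset.prod_congr rfl fun m hm => inHalf_baseFactor ?_
  have := (Finset.mem_Icc.1 hm).1
  omega

theorem inHalf_baseProd : inHalf baseProd = thetaProd := by
  ext1 d
  rw [thetaProd, coeff_mk, ← inHalf_prod_baseFactor d, inHalf, coeff_map, coeff_map, baseProd,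
    coeff_mk]

theorem coeff_baseProd {d N : ℕ} (h : d ≤ N) :
    coeff d baseProd = coeff d (∏ m ∈ Finset.Icc 1 N, baseFactor m) := by
  apply substSq_injective
  have h1 := congrArg (coeff d) inHalf_baseProd
  have h2 := congrArg (coeff d) (inHalf_prod_baseFactor N)
  rw [coeff_thetaProd h, ← h2, inHalf, coeff_map, coeff_map] at h1
  exact h1

/-- The Laurent polynomial `p - 2 + p⁻¹`. -/
def ySeries : LaurentSeries ℚ := gen - 2 + gen⁻¹

/-- The square of `K`, as an element of `ℚ((p))[[q]]`. -/
def phi : PowerSeries (LaurentSeries ℚ) := C ySeries * baseProd ^ 2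

theorem inHalf_phi : inHalf phi = K ^ 2 := by
  have h : substSq ySeries = (gen - gen⁻¹) ^ 2 := by
    have := gen_ne_zero
    simp only [ySeries, map_add, map_sub, map_ofNat, map_inv₀, substSq_gen]
    field_simp
    ring
  rw [phi, K, map_mul, map_pow, inHalf_baseProd, mul_pow, ← map_pow, ← h]
  simp [inHalf]

/-- `doubleVars` as a ring homomorphism. -/
def doubleVarsHom : PowerSeries (LaurentSeries ℚ) →+* PowerSeries (LaurentSeries ℚ) :=
  (PowerSeries.expand 2 two_ne_zero).toRingHom.comp (PowerSeries.map substSq)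

theorem doubleVarsHom_apply (F : PowerSeries (LaurentSeries ℚ)) :
    doubleVarsHom F = doubleVars F := rfl

theorem doubleVars_pow (F : PowerSeries (LaurentSeries ℚ)) (n : ℕ) :
    doubleVars (F ^ n) = doubleVars F ^ n :=
  map_pow doubleVarsHom F n

theorem doubleVars_inHalf (F : PowerSeries (LaurentSeries ℚ)) :
    doubleVars (inHalf F) = inHalf (doubleVars F) := by
  simp [doubleVars, inHalf]

theorem coeff_doubleVars (F : PowerSeries (LaurentSeries ℚ)) (n : ℕ) :
    coeff n (doubleVars F) = if 2 ∣ n then substSq (coeff (n / 2) F) else 0 := by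
  simp [doubleVars, coeff_expand]

/-- The inclusion of the constants in `ℚ((p))[[q]]`. -/
def ratC : ℚ →+* PowerSeries (LaurentSeries ℚ) := (C (R := LaurentSeries ℚ)).comp HahnSeries.C

theorem rat_smul_eq (c : ℚ) (F : PowerSeries (LaurentSeries ℚ)) : c • F = ratC c * F := by
  rw [Algebra.smul_def]
  congr 1
  exact RingHom.congr_fun (Subsingleton.elim (algebraMap ℚ (PowerSeries (LaurentSeries ℚ))) ratC) c

theorem map_ratC (f : PowerSeries (LaurentSeries ℚ) →+* PowerSeries (LaurentSeries ℚ)) (c : ℚ) :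
    f (ratC c) = ratC c :=
  RingHom.congr_fun (Subsingleton.elim (f.comp ratC) ratC) c

theorem isCoeffsOne_iff (f : ℕ → LaurentSeries ℚ) :
    IsCoeffsOne f ↔ PowerSeries.mk f = phi := by
  rw [IsCoeffsOne, ← inHalf_phi, inHalf_injective.eq_iff]

/-- The second generating series, as an element of `ℚ((p))[[q]]`. -/
def secondSeries : PowerSeries (LaurentSeries ℚ) :=
  (3 / 2 : ℚ) • (phi ^ 2 * weierstrassP) + (3 / 8 : ℚ) • doubleVars phi

theorem isCoeffsTwo_iff (g : ℕ → LaurentSeries ℚ) :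
    IsCoeffsTwo g ↔ PowerSeries.mk g = secondSeries := by
  have h : inHalf secondSeries =
      (3 / 2 : ℚ) • (K ^ 4 * inHalf weierstrassP) + (3 / 8 : ℚ) • (doubleVars K) ^ 2 := by
    rw [secondSeries, map_add, rat_smul_eq, rat_smul_eq, rat_smul_eq, rat_smul_eq,
      map_mul, map_mul, map_mul, map_pow, map_ratC, map_ratC, inHalf_phi,
      ← doubleVars_inHalf, inHalf_phi, doubleVars_pow]
    ring_nf
  rw [IsCoeffsTwo, ← h, inHalf_injective.eq_iff]

theorem existsUnique_mk_eq (F : PowerSeries (LaurentSeries ℚ)) :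
    ∃! f : ℕ → LaurentSeries ℚ, PowerSeries.mk f = F := by
  refine ⟨fun n => coeff n F, by ext1; simp, fun f hf => ?_⟩
  funext n
  simp [← hf]

/-- The series whose coefficient of `q^d` is the coefficient of `q^(2d)` of the given one. -/
def evenPart {R : Type*} [Semiring R] (F : PowerSeries R) : PowerSeries R :=
  PowerSeries.mk fun d => coeff (2 * d) F

/-- Eight times the defect of the identity to be proved. -/
def defect : PowerSeries (LaurentSeries ℚ) :=
  12 * (phi ^ 2 * weierstrassP) - doubleVars phi - 8 * evenPart phi

theorem coeff_secondSeries_of_defect (h : defect = 0) (d : ℕ) :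
    coeff d secondSeries =
      coeff (2 * d) phi + if 2 ∣ d then (1 / 2 : ℚ) • substSq (coeff (d / 2) phi) else 0 := by
  -- All scalars become integer multiples of the single atom `ratC (1 / 8)`, since `defect` is eight
  -- times the difference.
  have e1 : ratC (3 / 2) = 12 * ratC (1 / 8) := by
    rw [show (3 / 2 : ℚ) = 12 * (1 / 8) by norm_num, map_mul, map_ofNat]
  have e2 : ratC (3 / 8) = 3 * ratC (1 / 8) := by
    rw [show (3 / 8 : ℚ) = 3 * (1 / 8) by norm_num, map_mul, map_ofNat]
  have e3 : ratC (1 / 2) = 4 * ratC (1 / 8) := by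
    rw [show (1 / 2 : ℚ) = 4 * (1 / 8) by norm_num, map_mul, map_ofNat]
  have e4 : 8 * ratC (1 / 8) = 1 := by
    rw [← map_ofNat ratC 8, ← map_mul]
    norm_num
  have h1 : secondSeries = evenPart phi + ratC (1 / 2) * doubleVars phi := by
    unfold defect at h
    rw [secondSeries, rat_smul_eq, rat_smul_eq, e1, e2, e3]
    linear_combination ratC (1 / 8) * h + evenPart phi * e4
  rw [h1, map_add, evenPart, coeff_mk, ratC, RingHom.comp_apply, coeff_C_mul, coeff_doubleVars]
  split_ifs
  · rw [HahnSeries.C_mul_eq_smul]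
  · rw [mul_zero]

/-! ### The variables `a = p` and `b = q / p` -/

/-- Exchange of the variables `a` and `b` in `ℚ[[a]][[b]]`. -/
def swapVars (G : PowerSeries (PowerSeries ℚ)) : PowerSeries (PowerSeries ℚ) :=
  PowerSeries.mk fun j => PowerSeries.mk fun i => coeff j (coeff i G)

theorem coeff_coeff_swapVars (G : PowerSeries (PowerSeries ℚ)) (i j : ℕ) :
    coeff i (coeff j (swapVars G)) = coeff j (coeff i G) := by
  simp [swapVars]

theorem coeff_coeff_mul (G H : PowerSeries (PowerSeries ℚ)) (i j : ℕ) :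
    coeff i (coeff j (G * H)) = ∑ x ∈ Finset.HasAntidiagonal.antidiagonal j,
      ∑ y ∈ Finset.HasAntidiagonal.antidiagonal i, coeff y.1 (coeff x.1 G) * coeff y.2 (coeff x.2 H) := by
  rw [coeff_mul, map_sum]
  exact Finset.sum_congr rfl fun x _ => coeff_mul _ _ _

theorem swapVars_mul (G H : PowerSeries (PowerSeries ℚ)) :
    swapVars (G * H) = swapVars G * swapVars H := by
  ext j i
  rw [coeff_coeff_swapVars, coeff_coeff_mul, coeff_coeff_mul, Finset.sum_comm]
  simp [coeff_coeff_swapVars]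

theorem swapVars_add (G H : PowerSeries (PowerSeries ℚ)) :
    swapVars (G + H) = swapVars G + swapVars H := by
  ext j i
  simp [coeff_coeff_swapVars]

theorem swapVars_monomial (i j : ℕ) (c : ℚ) :
    swapVars (monomial j (monomial i c)) = monomial i (monomial j c) := by
  ext n m
  rw [coeff_coeff_swapVars, coeff_monomial, coeff_monomial]
  split_ifs <;> simp_all [coeff_monomial]

theorem swapVars_one : swapVars 1 = 1 := by
  have h := swapVars_monomial 0 0 1
  rwa [monomial_zero_eq_C_apply, monomial_zero_eq_C_apply, map_one, map_one] at h

/-- `swapVars` as a ring homomorphism. -/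
def swapHom : PowerSeries (PowerSeries ℚ) →+* PowerSeries (PowerSeries ℚ) where
  toFun := swapVars
  map_one' := swapVars_one
  map_mul' := swapVars_mul
  map_zero' := by ext j i; simp [coeff_coeff_swapVars]
  map_add' := swapVars_add

theorem coeff_coeff_swapHom (G : PowerSeries (PowerSeries ℚ)) (i j : ℕ) :
    coeff i (coeff j (swapHom G)) = coeff j (coeff i G) :=
  coeff_coeff_swapVars G i j

/-- The monomial `a^i b^j`. -/
def mono (i j : ℕ) : PowerSeries (PowerSeries ℚ) := C (X ^ i) * X ^ j

theorem swapHom_mono (i j : ℕ) : swapHom (mono i j) = mono j i := by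
  have h : ∀ i j, mono i j = monomial j (monomial i 1) := fun i j => by
    rw [mono, X_pow_eq, X_pow_eq, ← monomial_zero_eq_C_apply, monomial_mul_monomial, zero_add,
      mul_one]
  rw [h, h]
  exact swapVars_monomial i j 1

/-- The embedding `ℚ[[a]][[b]] → ℚ((p))[[q]]` with `a ↦ p` and `b ↦ q / p`. -/
def toLaurent : PowerSeries (PowerSeries ℚ) →+* PowerSeries (LaurentSeries ℚ) :=
  (PowerSeries.rescale gen⁻¹).comp (PowerSeries.map (HahnSeries.ofPowerSeries ℤ ℚ))

theorem coeff_toLaurent (G : PowerSeries (PowerSeries ℚ)) (n : ℕ) :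
    coeff n (toLaurent G) = gen ^ (-n : ℤ) * HahnSeries.ofPowerSeries ℤ ℚ (coeff n G) := by
  simp [toLaurent, coeff_rescale]

theorem coeff_toLaurent_injective {G H : PowerSeries (PowerSeries ℚ)} {n : ℕ}
    (h : coeff n (toLaurent G) = coeff n (toLaurent H)) : coeff n G = coeff n H := by
  rw [coeff_toLaurent, coeff_toLaurent] at h
  exact HahnSeries.ofPowerSeries_injective
    (mul_left_cancel₀ (zpow_ne_zero _ gen_ne_zero) h)

theorem coeff_coeff_toLaurent (G : PowerSeries (PowerSeries ℚ)) (n i : ℕ) (l : ℤ)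
    (h : (i : ℤ) = n + l) : (coeff n (toLaurent G)).coeff l = coeff i (coeff n G) := by
  rw [coeff_toLaurent, coeff_gen_zpow_mul, sub_neg_eq_add, add_comm, ← h,
    HahnSeries.ofPowerSeries_apply_coeff]

theorem coeff_ofPowerSeries_of_neg (f : PowerSeries ℚ) {l : ℤ} (hl : l < 0) :
    (HahnSeries.ofPowerSeries ℤ ℚ f).coeff l = 0 := by
  rw [HahnSeries.ofPowerSeries_apply]
  refine HahnSeries.embDomain_of_notMem_range ?_
  rintro ⟨a, ha⟩
  have : (a : ℤ) = l := ha
  omega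

theorem coeff_coeff_toLaurent_of_neg (G : PowerSeries (PowerSeries ℚ)) (n : ℕ) {l : ℤ}
    (h : n + l < 0) : (coeff n (toLaurent G)).coeff l = 0 := by
  rw [coeff_toLaurent, coeff_gen_zpow_mul]
  exact coeff_ofPowerSeries_of_neg _ (by omega)

theorem rescale_C_apply {R : Type*} [CommSemiring R] (a r : R) : rescale a (C r) = C r := by
  ext1 n
  rw [coeff_rescale, coeff_C]
  split_ifs with h <;> simp [h]

theorem toLaurent_mono (i j : ℕ) :
    toLaurent (mono i j) = C (gen ^ (i - j : ℤ)) * X ^ j := by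
  have h : HahnSeries.ofPowerSeries ℤ ℚ X = gen := HahnSeries.ofPowerSeries_X
  rw [zpow_sub₀ gen_ne_zero, zpow_natCast, zpow_natCast, div_eq_mul_inv, ← inv_pow]
  simp only [toLaurent, mono, RingHom.comp_apply, map_mul, map_pow, map_C, map_X, h, rescale_X]
  rw [rescale_C_apply, mul_pow, mul_assoc]

/-- The functional equation of a form of index `m`: invariance of `p^m F` under the exchange of
`p` and `q / p`, in terms of coefficients. -/
def IsQuasiPeriodic (m : ℤ) (F : PowerSeries (LaurentSeries ℚ)) : Prop :=
  (∀ (n n' : ℕ) (l : ℤ), (n' : ℤ) = n + l + m →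
    (coeff n F).coeff l = (coeff n' F).coeff (-l - 2 * m)) ∧
  ∀ (n : ℕ) (l : ℤ), n + l + m < 0 → (coeff n F).coeff l = 0

/-- The monomial p^(l+m) q^n is a^(n+l+m) b^n. Exchanging a and b gives p^(-l-m) q^(n+l+m), and a
negative exponent of a cannot occur. -/
theorem isQuasiPeriodic_of_eq_toLaurent {m : ℤ} {F : PowerSeries (LaurentSeries ℚ)}
    {G : PowerSeries (PowerSeries ℚ)} (hG : swapHom G = G) (h : C (gen ^ m) * F = toLaurent G) :
    IsQuasiPeriodic m F := by
  have h1 : ∀ (n : ℕ) (l : ℤ), (coeff n F).coeff l = (coeff n (toLaurent G)).coeff (l + m) := by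
    intro n l
    rw [← h, coeff_C_mul, coeff_gen_zpow_mul, add_sub_cancel_right]
  refine ⟨fun n n' l hl => ?_, fun n l hl => ?_⟩
  · rw [h1, h1, coeff_coeff_toLaurent G n n' _ (by omega),
      coeff_coeff_toLaurent G n' n _ (by omega)]
    conv_lhs => rw [← hG, coeff_coeff_swapHom]
  · rw [h1, coeff_coeff_toLaurent_of_neg _ _ (by omega)]

theorem IsQuasiPeriodic.sub {m : ℤ} {F F' : PowerSeries (LaurentSeries ℚ)}
    (h : IsQuasiPeriodic m F) (h' : IsQuasiPeriodic m F') : IsQuasiPeriodic m (F - F') := by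
  refine ⟨fun n n' l hl => ?_, fun n l hl => ?_⟩
  · rw [map_sub, map_sub, HahnSeries.coeff_sub, HahnSeries.coeff_sub, h.1 n n' l hl,
      h'.1 n n' l hl]
  · rw [map_sub, HahnSeries.coeff_sub, h.2 n l hl, h'.2 n l hl, sub_zero]

theorem IsQuasiPeriodic.natCast_mul {m : ℤ} {F : PowerSeries (LaurentSeries ℚ)}
    (h : IsQuasiPeriodic m F) (k : ℕ) : IsQuasiPeriodic m (k * F) := by
  refine ⟨fun n n' l hl => ?_, fun n l hl => ?_⟩
  · rw [← nsmul_eq_mul, map_nsmul, map_nsmul, HahnSeries.coeff_nsmul, HahnSeries.coeff_nsmul,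
      Pi.smul_apply, Pi.smul_apply, h.1 n n' l hl]
  · rw [← nsmul_eq_mul, map_nsmul, HahnSeries.coeff_nsmul, Pi.smul_apply, h.2 n l hl, smul_zero]

/-! ### The theta function in the variables `a`, `b` -/

/-- The inverse of `1 - a^m b^m`. -/
def invDiag (m : ℕ) : PowerSeries (PowerSeries ℚ) := invOfUnit (1 - mono m m) 1

theorem mul_invDiag {m : ℕ} (hm : m ≠ 0) : (1 - mono m m) * invDiag m = 1 :=
  mul_invOfUnit _ _ (by simp [mono, hm])

theorem swapHom_invDiag {m : ℕ} (hm : m ≠ 0) : swapHom (invDiag m) = invDiag m := by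
  have h1 := mul_invDiag hm
  have h2 := congrArg swapHom h1
  rw [map_mul, map_sub, map_one, swapHom_mono] at h2
  linear_combination (invDiag m) * h2 - (swapHom (invDiag m)) * h1

theorem toLaurent_mono_self (m : ℕ) : toLaurent (mono m m) = X ^ m := by
  simp [toLaurent_mono]

theorem toLaurent_invDiag {m : ℕ} (hm : m ≠ 0) : toLaurent (invDiag m) = (1 - X ^ m)⁻¹ := by
  rw [PowerSeries.eq_inv_iff_mul_eq_one (by simp [hm]), mul_comm]
  have := congrArg toLaurent (mul_invDiag hm)
  rwa [map_mul, map_sub, map_one, toLaurent_mono_self] at this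

/-- Symmetric truncations of `(1 - p) ∏_{m ≥ 1} (1 - p q^m) (1 - p⁻¹ q^m) / (1 - q^m)²`. -/
def symTrunc (N : ℕ) : PowerSeries (PowerSeries ℚ) :=
  ∏ m ∈ Finset.range N,
    ((1 - mono (m + 1) m) * (1 - mono m (m + 1)) * invDiag (m + 1) ^ 2)

theorem swapHom_symTrunc (N : ℕ) : swapHom (symTrunc N) = symTrunc N := by
  rw [symTrunc, map_prod]
  refine Finset.prod_congr rfl fun m _ => ?_
  rw [map_mul, map_mul, map_pow, map_sub, map_sub, map_one, swapHom_mono, swapHom_mono,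
    swapHom_invDiag (Nat.succ_ne_zero m)]
  ring

/-- Pairing 1 - p q^m with 1 - p⁻¹ q^(m+1) makes each factor symmetric under the exchange, at the
price of one unpaired factor 1 - p q^N. That factor is invisible below q^N. -/
theorem toLaurent_symTrunc (N : ℕ) :
    toLaurent (symTrunc N) * (1 - C gen * X ^ N) =
      C (1 - gen) * ∏ m ∈ Finset.Icc 1 N, baseFactor m := by
  induction N with
  | zero => simp [symTrunc]
  | succ N ih =>
    have h1 : toLaurent (mono (N + 1) N) = C gen * X ^ N := by
      rw [toLaurent_mono]; simp
    have h2 : toLaurent (mono N (N + 1)) = C gen⁻¹ * X ^ (N + 1) := by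
      rw [toLaurent_mono]; simp
    have h3 : ((1 - X ^ (N + 1) : PowerSeries (LaurentSeries ℚ)) ^ 2)⁻¹ =
        ((1 - X ^ (N + 1))⁻¹) ^ 2 := by
      rw [sq, sq, PowerSeries.mul_inv_rev]
    rw [Finset.prod_Icc_succ_top (by omega), ← mul_assoc, ← ih, symTrunc,
      Finset.prod_range_succ, ← symTrunc, baseFactor, h3]
    simp only [map_mul, map_sub, map_one, map_pow, h1, h2, toLaurent_invDiag (Nat.succ_ne_zero N)]
    ring

theorem coeff_toLaurent_symTrunc {n N : ℕ} (h : n < N) :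
    coeff n (toLaurent (symTrunc N)) = coeff n (C (1 - gen) * baseProd) := by
  have h1 := congrArg (coeff n) (toLaurent_symTrunc N)
  rw [mul_sub, mul_one, map_sub, mul_left_comm, ← mul_assoc, coeff_mul_X_pow', if_neg (by omega),
    sub_zero] at h1
  rw [h1, coeff_C_mul, coeff_C_mul, coeff_baseProd h.le]

/-- The series `(1 - p) ∏_{m ≥ 1} (1 - p q^m) (1 - p⁻¹ q^m) / (1 - q^m)²` in the variables
`a` and `b`. -/
def symTheta : PowerSeries (PowerSeries ℚ) :=
  PowerSeries.mk fun j => coeff j (symTrunc (j + 1))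

theorem coeff_symTheta {j N : ℕ} (h : j < N) : coeff j symTheta = coeff j (symTrunc N) := by
  rw [symTheta, coeff_mk]
  apply coeff_toLaurent_injective
  rw [coeff_toLaurent_symTrunc h, coeff_toLaurent_symTrunc (Nat.lt_succ_self j)]

theorem swapHom_symTheta : swapHom symTheta = symTheta := by
  ext j i
  -- A single truncation, long enough for both coefficients, carries the symmetry.
  rw [coeff_coeff_swapHom, coeff_symTheta (show i < i + j + 1 by omega),
    coeff_symTheta (show j < i + j + 1 by omega), ← coeff_coeff_swapHom, swapHom_symTrunc]

theorem toLaurent_symTheta : toLaurent symTheta = C (1 - gen) * baseProd := by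
  ext1 n
  rw [← coeff_toLaurent_symTrunc (Nat.lt_succ_self n), coeff_toLaurent, coeff_toLaurent,
    coeff_symTheta (Nat.lt_succ_self n)]

theorem C_gen_mul_phi : C gen * phi = toLaurent (symTheta ^ 2) := by
  have h : gen * ySeries = (1 - gen) ^ 2 := by
    have := gen_ne_zero
    unfold ySeries
    field_simp
    ring
  rw [map_pow, toLaurent_symTheta, mul_pow, ← map_pow, ← h, phi, map_mul]
  ring

theorem isQuasiPeriodic_phi : IsQuasiPeriodic 1 phi :=
  isQuasiPeriodic_of_eq_toLaurent (G := symTheta ^ 2) (by rw [map_pow, swapHom_symTheta])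
    (by rw [zpow_one, C_gen_mul_phi])

/-! ### The substitution `p ↦ p²`, `q ↦ q²` in the variables `a`, `b` -/

/-- The substitution `a ↦ a²`, `b ↦ b²`. -/
def symDouble (G : PowerSeries (PowerSeries ℚ)) : PowerSeries (PowerSeries ℚ) :=
  PowerSeries.expand 2 two_ne_zero
    (PowerSeries.map (PowerSeries.expand 2 two_ne_zero : PowerSeries ℚ →ₐ[ℚ] _).toRingHom G)

theorem coeff_coeff_symDouble (G : PowerSeries (PowerSeries ℚ)) (i j : ℕ) :
    coeff i (coeff j (symDouble G)) =
      if 2 ∣ i ∧ 2 ∣ j then coeff (i / 2) (coeff (j / 2) G) else 0 := by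
  rw [symDouble, coeff_expand]
  by_cases hj : 2 ∣ j <;> by_cases hi : 2 ∣ i <;> simp [hi, hj, coeff_expand]

theorem swapHom_symDouble {G : PowerSeries (PowerSeries ℚ)} (hG : swapHom G = G) :
    swapHom (symDouble G) = symDouble G := by
  ext j i
  rw [coeff_coeff_swapHom, coeff_coeff_symDouble, coeff_coeff_symDouble,
    ← coeff_coeff_swapHom, hG]
  exact if_congr and_comm rfl rfl

theorem substSq_ofPowerSeries (f : PowerSeries ℚ) :
    substSq (HahnSeries.ofPowerSeries ℤ ℚ f) =
      HahnSeries.ofPowerSeries ℤ ℚ (PowerSeries.expand 2 two_ne_zero f) := by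
  ext l
  rcases lt_or_ge l 0 with hl | hl
  · rw [coeff_ofPowerSeries_of_neg _ hl]
    obtain ⟨k, rfl | rfl⟩ := Int.even_or_odd' l
    · rw [coeff_substSq_two_mul, coeff_ofPowerSeries_of_neg _ (by omega)]
    · rw [coeff_substSq_odd]
  · obtain ⟨n, rfl⟩ := Int.eq_ofNat_of_zero_le hl
    rw [HahnSeries.ofPowerSeries_apply_coeff, coeff_expand]
    obtain ⟨k, rfl | rfl⟩ := Nat.even_or_odd' n
    · push_cast
      rw [coeff_substSq_two_mul, HahnSeries.ofPowerSeries_apply_coeff, if_pos (dvd_mul_right 2 k),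
        Nat.mul_div_cancel_left _ two_pos]
    · push_cast
      rw [coeff_substSq_odd, if_neg (by omega)]

theorem doubleVars_toLaurent (G : PowerSeries (PowerSeries ℚ)) :
    doubleVars (toLaurent G) = toLaurent (symDouble G) := by
  ext1 n
  rw [coeff_doubleVars, coeff_toLaurent _ n, symDouble, coeff_expand]
  split_ifs with h
  · obtain ⟨k, rfl⟩ := h
    rw [Nat.mul_div_cancel_left _ two_pos, coeff_toLaurent, map_mul, map_zpow₀, substSq_gen,
      substSq_ofPowerSeries, coeff_map, ← zpow_natCast, ← zpow_mul]
    congr 2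
    push_cast
    ring
  · simp

theorem isQuasiPeriodic_doubleVars_phi : IsQuasiPeriodic 2 (doubleVars phi) := by
  refine isQuasiPeriodic_of_eq_toLaurent (G := symDouble (symTheta ^ 2))
    (swapHom_symDouble (by rw [map_pow, swapHom_symTheta])) ?_
  rw [← doubleVars_toLaurent, ← C_gen_mul_phi, ← doubleVarsHom_apply, ← doubleVarsHom_apply,
    map_mul]
  congr 1
  rw [doubleVarsHom_apply, doubleVars, map_C, substSq_gen, expand_C]
  rfl

/-! ### The Weierstrass function in the variables `a`, `b` -/

/-- The Weierstrass function in the variables `a`, `b`. -/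
def symWeierstrass : PowerSeries (PowerSeries ℚ) :=
  PowerSeries.mk fun j =>
    if j = 0 then C (1 / 12) + PowerSeries.mk fun k => (k : ℚ)
    else ∑ m ∈ j.divisors, (m : PowerSeries ℚ) * (X ^ (j + m) - 2 * X ^ j + X ^ (j - m))

theorem coeff_natCast_mul' {R : Type*} [Semiring R] (n m : ℕ) (f : PowerSeries R) :
    coeff n ((m : PowerSeries R) * f) = m * coeff n f := by
  rw [← map_natCast (C (R := R)), coeff_C_mul]

theorem coeff_coeff_symWeierstrass {i j : ℕ} (hj : j ≠ 0) (hij : i ≠ j) :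
    coeff i (coeff j symWeierstrass) =
      ∑ m ∈ j.divisors, if i = j + m ∨ i = j - m then (m : ℚ) else 0 := by
  rw [symWeierstrass, coeff_mk, if_neg hj, map_sum]
  refine Finset.sum_congr rfl fun m hm => ?_
  have hmj := Nat.divisor_le hm
  have hm0 := Nat.pos_of_mem_divisors hm
  rw [coeff_natCast_mul', map_add, map_sub, ← Nat.cast_ofNat (R := PowerSeries ℚ) (n := 2),
    coeff_natCast_mul', coeff_X_pow, coeff_X_pow, coeff_X_pow, if_neg hij]
  split_ifs <;> first | omega | simp

theorem coeff_coeff_symWeierstrass_of_lt {i j : ℕ} (h : i < j) :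
    coeff i (coeff j symWeierstrass) = if (j - i) ∣ j then ((j - i : ℕ) : ℚ) else 0 := by
  have hj : j ≠ 0 := by omega
  have h1 : ∀ m ∈ j.divisors, (if i = j + m ∨ i = j - m then (m : ℚ) else 0) =
      if m = j - i then (m : ℚ) else 0 := fun m hm => by
    have := Nat.divisor_le hm
    exact if_congr (by omega) rfl rfl
  rw [coeff_coeff_symWeierstrass hj h.ne, Finset.sum_congr rfl h1, Finset.sum_ite_eq']
  simp [hj]

theorem coeff_coeff_symWeierstrass_of_gt {i j : ℕ} (h : j < i) :
    coeff i (coeff j symWeierstrass) = if (i - j) ∣ j then ((i - j : ℕ) : ℚ) else 0 := by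
  -- For j = 0 the divisibility always holds, and the formula reproduces p/(1 - p)² = ∑ k p^k; the
  -- expansion at p = 0 is what fits the symmetric pattern.
  rcases eq_or_ne j 0 with rfl | hj
  · simp [symWeierstrass, coeff_C, h.ne']
  · have h1 : ∀ m ∈ j.divisors, (if i = j + m ∨ i = j - m then (m : ℚ) else 0) =
        if m = i - j then (m : ℚ) else 0 := fun m hm => by
      have := Nat.divisor_le hm
      exact if_congr (by omega) rfl rfl
    rw [coeff_coeff_symWeierstrass hj h.ne', Finset.sum_congr rfl h1, Finset.sum_ite_eq']
    simp [hj]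

theorem swapHom_symWeierstrass : swapHom symWeierstrass = symWeierstrass := by
  have key : ∀ i j : ℕ, i < j →
      coeff i (coeff j symWeierstrass) = coeff j (coeff i symWeierstrass) := fun i j h => by
    rw [coeff_coeff_symWeierstrass_of_lt h, coeff_coeff_symWeierstrass_of_gt h]
    refine if_congr ?_ rfl rfl
    -- The symmetry of ℘: j - i divides j exactly when it divides i.
    have h1 := Nat.dvd_add_right (c := i) (dvd_refl (j - i))
    rwa [Nat.sub_add_cancel h.le] at h1
  ext j i
  rw [coeff_coeff_swapHom]
  rcases lt_trichotomy i j with h | rfl | h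
  · exact (key i j h).symm
  · rfl
  · exact key j i h

theorem mk_natCast_mul_one_sub_X_sq :
    (PowerSeries.mk fun k => (k : ℚ)) * (1 - X) ^ 2 = X := by
  have h1 : (PowerSeries.mk fun k => (k : ℚ)) * (1 - X) = X * PowerSeries.mk 1 := by
    ext n
    rw [mul_sub, mul_one, map_sub]
    rcases n with - | n
    · simp
    · rw [coeff_succ_mul_X, coeff_succ_X_mul]
      simp
  rw [sq, ← mul_assoc, h1, mul_assoc, mk_one_mul_one_sub_eq_one, mul_one]

theorem toLaurent_symWeierstrass : toLaurent symWeierstrass = weierstrassP := by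
  have hX : HahnSeries.ofPowerSeries ℤ ℚ X = gen := HahnSeries.ofPowerSeries_X
  have hg := gen_ne_zero
  ext1 n
  rw [coeff_toLaurent, symWeierstrass, weierstrassP, coeff_mk, coeff_mk]
  split_ifs with hn
  · subst hn
    have h1 := one_sub_gen_ne_zero
    have h2 := congrArg (HahnSeries.ofPowerSeries ℤ ℚ) mk_natCast_mul_one_sub_X_sq
    rw [map_mul, map_pow, map_sub, map_one, hX] at h2
    rw [map_add, HahnSeries.ofPowerSeries_C, eq_div_of_mul_eq (pow_ne_zero 2 h1) h2]
    simp
  · rw [map_sum, Finset.mul_sum]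
    refine Finset.sum_congr rfl fun m hm => ?_
    have hmn := Nat.divisor_le hm
    simp only [map_mul, map_add, map_sub, map_pow, hX, map_natCast, map_ofNat]
    rw [pow_sub₀ _ hg hmn, pow_add, zpow_neg, zpow_natCast]
    field_simp

theorem isQuasiPeriodic_phi_sq_mul_weierstrassP : IsQuasiPeriodic 2 (phi ^ 2 * weierstrassP) := by
  refine isQuasiPeriodic_of_eq_toLaurent (G := (symTheta ^ 2) ^ 2 * symWeierstrass) ?_ ?_
  · rw [map_mul, map_pow, map_pow, swapHom_symTheta, swapHom_symWeierstrass]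
  · rw [map_mul, map_pow, ← C_gen_mul_phi, toLaurent_symWeierstrass, mul_pow, ← map_pow, mul_assoc]
    rfl

/-! ### Symmetric Laurent polynomials as polynomials in `Y = p - 2 + p⁻¹` -/

/-- Evaluation of polynomials at `Y = p - 2 + p⁻¹`. -/
def evalY : Polynomial ℚ →+* LaurentSeries ℚ := Polynomial.eval₂RingHom HahnSeries.C ySeries

theorem evalY_X : evalY Polynomial.X = ySeries := by simp [evalY]

theorem evalY_C (c : ℚ) : evalY (Polynomial.C c) = HahnSeries.C c := by simp [evalY]

/-- Y is fixed by p ↦ p⁻¹, but this is not a substitution on ℚ((p)). The symmetry is therefore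
propagated through the three-term recursion for multiplication by Y. -/
theorem evalY_neg_coeff (Q : Polynomial ℚ) (l : ℤ) :
    (evalY Q).coeff (-l) = (evalY Q).coeff l := by
  have hpow : ∀ (k : ℕ) (l : ℤ), (ySeries ^ k).coeff (-l) = (ySeries ^ k).coeff l := by
    intro k
    induction k with
    | zero =>
      intro l
      by_cases hl : l = 0
      · simp [hl]
      · simp [HahnSeries.coeff_one, hl]
    | succ k ih =>
      intro l
      have h : ∀ l, (ySeries ^ (k + 1)).coeff l =
          (ySeries ^ k).coeff (l - 1) - (2 : ℕ) • (ySeries ^ k).coeff l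
            + (ySeries ^ k).coeff (l + 1) := by
        intro l
        have : ySeries ^ (k + 1) = gen * ySeries ^ k - (2 : ℕ) • ySeries ^ k
            + gen⁻¹ * ySeries ^ k := by
          have hy : ySeries = gen - 2 + gen⁻¹ := rfl
          rw [nsmul_eq_mul, Nat.cast_ofNat]
          linear_combination ySeries ^ k * hy
        rw [this, HahnSeries.coeff_add, HahnSeries.coeff_sub, HahnSeries.coeff_nsmul,
          Pi.smul_apply, coeff_gen_mul, coeff_gen_inv_mul]
      rw [h, h, ih l, ← ih (l - 1), ← ih (l + 1)]
      rw [show -(l - 1) = -l + 1 by ring, show -(l + 1) = -l - 1 by ring]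
      ring
  induction Q using Polynomial.induction_on' with
  | add A B hA hB => rw [map_add, HahnSeries.coeff_add, HahnSeries.coeff_add, hA, hB]
  | monomial k c =>
    rw [← Polynomial.C_mul_X_pow_eq_monomial, map_mul, map_pow, evalY_X, evalY_C,
      HahnSeries.C_mul_eq_smul, HahnSeries.coeff_smul, HahnSeries.coeff_smul, hpow]

/-- Since Y^k = p^(-k) (1 - p)^(2k), the lowest term of Y^k is p^(-k), with coefficient 1. -/
theorem coeff_ySeries_pow (k N : ℕ) (h : k ≤ N) :
    (ySeries ^ k).coeff (-N : ℤ) = if k = N then 1 else 0 := by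
  have hX : HahnSeries.ofPowerSeries ℤ ℚ X = gen := HahnSeries.ofPowerSeries_X
  have h1 : ySeries ^ k =
      gen ^ (-k : ℤ) * HahnSeries.ofPowerSeries ℤ ℚ (((1 - X) ^ 2) ^ k) := by
    have := gen_ne_zero
    rw [map_pow, map_pow, map_sub, map_one, hX, zpow_neg, zpow_natCast, ← inv_pow, ← mul_pow]
    congr 1
    rw [ySeries]
    field_simp
    ring
  rw [h1, coeff_gen_zpow_mul]
  split_ifs with hk
  · have h2 := HahnSeries.ofPowerSeries_apply_coeff (Γ := ℤ) (((1 - X : PowerSeries ℚ) ^ 2) ^ k) 0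
    rw [hk, sub_self]
    rw [hk, Nat.cast_zero] at h2
    rw [h2]
    simp
  · exact coeff_ofPowerSeries_of_neg _ (by omega)

theorem coeff_evalY_natDegree (Q : Polynomial ℚ) :
    (evalY Q).coeff (-(Q.natDegree : ℤ)) = Q.leadingCoeff := by
  have h : evalY Q = ∑ k ∈ Finset.range (Q.natDegree + 1), Q.coeff k • ySeries ^ k := by
    simp only [evalY, Polynomial.coe_eval₂RingHom, Polynomial.eval₂_eq_sum_range,
      HahnSeries.C_mul_eq_smul]
  rw [h, HahnSeries.coeff_sum, Finset.sum_eq_single Q.natDegree]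
  · rw [HahnSeries.coeff_smul, coeff_ySeries_pow _ _ le_rfl, if_pos rfl, smul_eq_mul, mul_one]
    rfl
  · intro k hk hkN
    have := Finset.mem_range.1 hk
    rw [HahnSeries.coeff_smul, coeff_ySeries_pow _ _ (by omega), if_neg hkN, smul_zero]
  · simp

/-- The map `ℚ[Y][[q]] → ℚ((p))[[q]]`. -/
def evalYSeries : PowerSeries (Polynomial ℚ) →+* PowerSeries (LaurentSeries ℚ) :=
  PowerSeries.map evalY

theorem eq_zero_of_isQuasiPeriodic {R : PowerSeries (Polynomial ℚ)}
    (h : IsQuasiPeriodic 2 (evalYSeries (C (Polynomial.X ^ 3) * R))) :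
    evalYSeries (C (Polynomial.X ^ 3) * R) = 0 := by
  set F := evalYSeries (C (Polynomial.X ^ 3) * R) with hF
  have hrow : ∀ n, coeff n F = evalY (Polynomial.X ^ 3 * coeff n R) := fun n => by
    rw [hF, evalYSeries, coeff_map, coeff_C_mul]
  ext1 n
  rw [map_zero]
  induction n using Nat.strong_induction_on with
  | _ n ih =>
    have hsmall : ∀ l : ℤ, l ≤ -3 → (coeff n F).coeff l = 0 := by
      intro l hl
      -- When n + l + 2 is nonnegative it is smaller than n, because l ≤ -3; the induction
      -- hypothesis applies there.
      rcases lt_or_ge ((n : ℤ) + l + 2) 0 with h0 | h0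
      · exact h.2 n l h0
      · obtain ⟨n', hn'⟩ := Int.eq_ofNat_of_zero_le h0
        rw [h.1 n n' l hn'.symm, ih n' (by omega), HahnSeries.coeff_zero]
    by_contra hne
    have hQ : Polynomial.X ^ 3 * coeff n R ≠ 0 := fun h0 => hne (by rw [hrow, h0, map_zero])
    have hR : coeff n R ≠ 0 := right_ne_zero_of_mul hQ
    have hdeg : (Polynomial.X ^ 3 * coeff n R).natDegree = 3 + (coeff n R).natDegree := by
      rw [Polynomial.natDegree_mul (pow_ne_zero 3 Polynomial.X_ne_zero) hR,
        Polynomial.natDegree_X_pow]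
    have h1 := coeff_evalY_natDegree (Polynomial.X ^ 3 * coeff n R)
    rw [← hrow, hsmall _ (by omega)] at h1
    exact hQ (Polynomial.leadingCoeff_eq_zero.1 h1.symm)

/-! ### Lambert series -/

/-- The Lambert series `q^m / (1 - q^m)²`. -/
def lambert (m : ℕ) : PowerSeries ℚ :=
  PowerSeries.mk fun d => if m ∣ d then ((d / m : ℕ) : ℚ) else 0

theorem lambert_mul {m : ℕ} (hm : m ≠ 0) : lambert m * (1 - X ^ m) ^ 2 = X ^ m := by
  have h : lambert m = PowerSeries.expand m hm (PowerSeries.mk fun k => (k : ℚ)) := by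
    ext d
    simp [lambert, coeff_expand]
  have h1 := congrArg (PowerSeries.expand m hm) mk_natCast_mul_one_sub_X_sq
  simpa [h] using h1

/-- The series `∑ σ(d) q^d`. -/
def sigmaSeries : PowerSeries ℚ :=
  PowerSeries.mk fun d => (ArithmeticFunction.sigma 1 d : ℚ)

theorem coeff_sum_lambert (d : ℕ) :
    coeff d (∑ m ∈ Finset.Icc 1 d, lambert m) = coeff d sigmaSeries := by
  have h : d.divisors = (Finset.Icc 1 d).filter (· ∣ d) := by
    ext m
    simp only [Nat.mem_divisors, Finset.mem_filter, Finset.mem_Icc]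
    refine ⟨fun ⟨h1, h2⟩ => ⟨⟨Nat.pos_of_dvd_of_pos h1 (Nat.pos_of_ne_zero h2),
      Nat.le_of_dvd (Nat.pos_of_ne_zero h2) h1⟩, h1⟩, fun ⟨h1, h2⟩ => ⟨h2, by omega⟩⟩
  rw [map_sum, sigmaSeries, coeff_mk, ArithmeticFunction.sigma_one_apply,
    ← Nat.sum_div_divisors d (fun n => n), h, Finset.sum_filter, Nat.cast_sum]
  refine Finset.sum_congr rfl fun m _ => ?_
  rw [lambert, coeff_mk]
  split_ifs <;> simp

/-- The Hecke relation at 2: write n = 2^a m with m odd and use σ(2^j m) = (2^(j+1) - 1) σ(m) for j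
= a + 1, a and, if a > 0, a - 1. -/
theorem sigma_two_mul_add (n : ℕ) :
    ArithmeticFunction.sigma 1 (2 * n) +
        2 * (if 2 ∣ n then ArithmeticFunction.sigma 1 (n / 2) else 0) =
      3 * ArithmeticFunction.sigma 1 n := by
  rcases eq_or_ne n 0 with rfl | hn
  · simp
  obtain ⟨a, m, hm, rfl⟩ := Nat.exists_eq_two_pow_mul_odd hn
  have hgeom : ∀ n, ∑ k ∈ Finset.range n, 2 ^ k + 1 = 2 ^ n := by
    intro n
    induction n with
    | zero => simp
    | succ n ih => rw [Finset.sum_range_succ, add_right_comm, ih, pow_succ, mul_two]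
  have key : ∀ j, ArithmeticFunction.sigma 1 (2 ^ j * m) + ArithmeticFunction.sigma 1 m =
      2 ^ (j + 1) * ArithmeticFunction.sigma 1 m := by
    intro j
    have hc : Nat.Coprime (2 ^ j) m := (Nat.coprime_two_left.2 hm).pow_left j
    rw [ArithmeticFunction.isMultiplicative_sigma.map_mul_of_coprime hc,
      ArithmeticFunction.sigma_one_apply_prime_pow Nat.prime_two, ← hgeom (j + 1)]
    ring
  have h1 := key (a + 1)
  have h2 := key a
  rw [show 2 * (2 ^ a * m) = 2 ^ (a + 1) * m by ring]
  rcases a with - | a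
  · rw [if_neg (by simpa using (Nat.odd_iff.1 hm))]
    simp at h1 h2 ⊢
    omega
  · have h3 := key a
    rw [if_pos ⟨2 ^ a * m, by ring⟩, show 2 ^ (a + 1) * m / 2 = 2 ^ a * m by
      rw [show 2 ^ (a + 1) * m = 2 * (2 ^ a * m) by ring, Nat.mul_div_cancel_left _ two_pos]]
    have e1 : 2 ^ (a + 1 + 1 + 1) * ArithmeticFunction.sigma 1 m =
      8 * (2 ^ a * ArithmeticFunction.sigma 1 m) := by ring
    have e2 : 2 ^ (a + 1 + 1) * ArithmeticFunction.sigma 1 m =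
      4 * (2 ^ a * ArithmeticFunction.sigma 1 m) := by ring
    have e3 : 2 ^ (a + 1) * ArithmeticFunction.sigma 1 m =
      2 * (2 ^ a * ArithmeticFunction.sigma 1 m) := by ring
    omega

theorem evenPart_sigmaSeries :
    evenPart sigmaSeries + 2 * PowerSeries.expand 2 two_ne_zero sigmaSeries = 3 * sigmaSeries := by
  ext n
  have h := sigma_two_mul_add n
  rw [map_add, ← Nat.cast_ofNat (R := PowerSeries ℚ) (n := 2),
    ← Nat.cast_ofNat (R := PowerSeries ℚ) (n := 3), coeff_natCast_mul', coeff_natCast_mul',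
    coeff_expand, evenPart, coeff_mk, sigmaSeries, coeff_mk, coeff_mk, coeff_mk]
  split_ifs at h ⊢ <;> exact_mod_cast h

/-! ### Expansion of the defect at `Y = 0` -/

theorem C_dvd_of_forall_coeff {R : Type*} [CommSemiring R] {r : R} {A : PowerSeries R}
    (h : ∀ d, r ∣ coeff d A) : C r ∣ A := by
  choose B hB using h
  exact ⟨PowerSeries.mk B, by ext1 d; rw [coeff_C_mul, coeff_mk, hB]⟩

theorem sq_dvd_prod_one_sub {R ι : Type*} [CommRing R] (y : R) (w : ι → R) (s : Finset ι) :
    y ^ 2 ∣ ∏ i ∈ s, (1 - y * w i) - (1 - y * ∑ i ∈ s, w i) := by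
  classical
  induction s using Finset.induction_on with
  | empty => simp
  | insert i s hi ih =>
    obtain ⟨c, hc⟩ := ih
    rw [Finset.prod_insert hi, Finset.sum_insert hi]
    exact ⟨c * (1 - y * w i) + w i * ∑ i ∈ s, w i, by linear_combination (1 - y * w i) * hc⟩

/-- The inclusion of `ℚ[[q]]` in `ℚ[Y][[q]]`. -/
def constLift : PowerSeries ℚ →+* PowerSeries (Polynomial ℚ) := PowerSeries.map Polynomial.C

/-- The preimage of `baseProd` in `ℚ[Y][[q]]`. -/
def polyProd : PowerSeries (Polynomial ℚ) :=
  PowerSeries.mk fun d => coeff d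
    (∏ m ∈ Finset.Icc 1 d, (1 - C Polynomial.X * constLift (lambert m)))

theorem evalYSeries_C (Q : Polynomial ℚ) : evalYSeries (C Q) = C (evalY Q) := by
  simp [evalYSeries]

/-- This is (1 - p q^m)(1 - p⁻¹ q^m) = (1 - q^m)² - Y q^m divided by (1 - q^m)². -/
theorem evalYSeries_factor {m : ℕ} (hm : m ≠ 0) :
    evalYSeries (1 - C Polynomial.X * constLift (lambert m)) = baseFactor m := by
  have hc : constantCoeff ((1 - X ^ m : PowerSeries (LaurentSeries ℚ)) ^ 2) ≠ 0 := by simp [hm]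
  have h1 := congrArg (fun A => evalYSeries (constLift A)) (lambert_mul hm)
  simp only [map_mul, map_pow, map_sub, map_one] at h1
  have h2 : evalYSeries (constLift X) = X := by simp [evalYSeries, constLift]
  have h3 : (C gen : PowerSeries (LaurentSeries ℚ)) * C gen⁻¹ = 1 := by
    rw [← map_mul, mul_inv_cancel₀ gen_ne_zero, map_one]
  have h4 : (C ySeries : PowerSeries (LaurentSeries ℚ)) = C gen - 2 + C gen⁻¹ := by
    rw [ySeries, map_add, map_sub, map_ofNat]
  rw [h2] at h1
  rw [baseFactor, PowerSeries.eq_mul_inv_iff_mul_eq hc, map_sub, map_mul, map_one, evalYSeries_C,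
    evalY_X, h4]
  linear_combination (-(C gen - 2 + C gen⁻¹)) * h1 - X ^ m * X ^ m * h3

theorem evalYSeries_polyProd : evalYSeries polyProd = baseProd := by
  ext1 d
  have h : evalYSeries (∏ m ∈ Finset.Icc 1 d, (1 - C Polynomial.X * constLift (lambert m))) =
      ∏ m ∈ Finset.Icc 1 d, baseFactor m := by
    rw [map_prod]
    refine Finset.prod_congr rfl fun m hm => evalYSeries_factor ?_
    have := (Finset.mem_Icc.1 hm).1
    omega
  rw [baseProd, coeff_mk, ← h, evalYSeries, coeff_map, coeff_map, polyProd, coeff_mk]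

theorem exists_polyProd_eq : ∃ R, polyProd =
    1 - C Polynomial.X * constLift sigmaSeries + C Polynomial.X ^ 2 * R := by
  have h : C (Polynomial.X ^ 2) ∣ polyProd - (1 - C Polynomial.X * constLift sigmaSeries) := by
    refine C_dvd_of_forall_coeff fun d => ?_
    obtain ⟨c, hc⟩ := sq_dvd_prod_one_sub (C Polynomial.X : PowerSeries (Polynomial ℚ))
      (fun m => constLift (lambert m)) (Finset.Icc 1 d)
    refine ⟨coeff d c, ?_⟩
    have hs : coeff d (constLift (∑ m ∈ Finset.Icc 1 d, lambert m)) =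
        coeff d (constLift sigmaSeries) := by
      rw [constLift, coeff_map, coeff_map, coeff_sum_lambert]
    have h1 := congrArg (coeff d) hc
    rw [← map_pow, coeff_C_mul, ← map_sum, map_sub, map_sub, coeff_C_mul, hs] at h1
    rw [← h1, polyProd, map_sub, coeff_mk, map_sub, coeff_C_mul]
  obtain ⟨R, hR⟩ := h
  exact ⟨R, by rw [← map_pow, ← hR]; ring⟩

theorem exists_evalY_eq_pow_add_inv (m : ℕ) :
    ∃ T : Polynomial ℚ, evalY (Polynomial.X * T) = gen ^ m - 2 + (gen ^ m)⁻¹ := by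
  have hg := gen_ne_zero
  induction m using Nat.twoStepInduction with
  | zero => exact ⟨0, by rw [mul_zero, map_zero, pow_zero, inv_one]; ring⟩
  | one => exact ⟨1, by rw [mul_one, evalY_X, pow_one, ySeries]⟩
  | more m h0 h1 =>
    obtain ⟨T0, h0⟩ := h0
    obtain ⟨T1, h1⟩ := h1
    -- From the Chebyshev-type recursion (p + p⁻¹)(p^(m+1) + p^(-m-1)) = p^(m+2) + p^(-m-2) + p^m +
    -- p^(-m), with p + p⁻¹ = Y + 2.
    refine ⟨T1 * (Polynomial.X + 2) - T0 + 2, ?_⟩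
    rw [map_mul, evalY_X] at h0 h1 ⊢
    have h2 : ySeries * evalY (T1 * (Polynomial.X + 2) - T0 + 2) =
        ySeries * evalY T1 * (ySeries + 2) - ySeries * evalY T0 + 2 * ySeries := by
      rw [map_add, map_sub, map_mul, map_add, evalY_X, map_ofNat]
      ring
    rw [h2, h0, h1, ySeries]
    field_simp
    ring

/-- Here p/(1 - p)² = 1/Y gives the leading 1. The terms with d ≥ 1 are already divisible by Y, so
after multiplication they only enter at order Y². -/
theorem exists_evalYSeries_eq_ySeries_mul_weierstrassP :
    ∃ R, C ySeries * weierstrassP =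
      evalYSeries (1 + C Polynomial.X * C (Polynomial.C (1 / 12)) + C Polynomial.X ^ 2 * R) := by
  choose T hT using exists_evalY_eq_pow_add_inv
  refine ⟨PowerSeries.mk fun d => if d = 0 then 0 else ∑ m ∈ d.divisors, (m : Polynomial ℚ) * T m,
    ?_⟩
  have hg := gen_ne_zero
  have hg1 := one_sub_gen_ne_zero
  ext1 d
  rw [coeff_C_mul, weierstrassP, coeff_mk, evalYSeries, coeff_map, map_add, map_add, ← map_pow,
    ← map_mul C, coeff_C_mul, coeff_mk, map_add (coeff d), coeff_one, coeff_C]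
  split_ifs with hd
  · rw [mul_zero, map_zero, add_zero, map_add, map_one, map_mul, evalY_X, evalY_C,
      show HahnSeries.C (1 / 12 : ℚ) = (1 / 12 : LaurentSeries ℚ) by simp, mul_add, add_comm]
    congr 1
    rw [ySeries]
    field_simp
    ring
  · rw [add_zero, map_zero, zero_add, map_mul, map_pow, evalY_X, sq, mul_assoc]
    congr 1
    rw [map_sum, Finset.mul_sum]
    refine Finset.sum_congr rfl fun m _ => ?_
    rw [← hT, map_mul, map_mul, evalY_X, map_natCast]
    ring

/-- The substitution `Y ↦ Y² + 4 Y`, which corresponds to `p ↦ p²`. -/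
def polyDouble : Polynomial ℚ →+* Polynomial ℚ :=
  Polynomial.eval₂RingHom Polynomial.C (Polynomial.X ^ 2 + 4 * Polynomial.X)

theorem substSq_evalY (Q : Polynomial ℚ) : substSq (evalY Q) = evalY (polyDouble Q) := by
  have h : substSq.comp evalY = evalY.comp polyDouble := by
    refine Polynomial.ringHom_ext' (Subsingleton.elim _ _) ?_
    have := gen_ne_zero
    rw [RingHom.comp_apply, RingHom.comp_apply, evalY_X, polyDouble, Polynomial.coe_eval₂RingHom,
      Polynomial.eval₂_X, map_add, map_mul, map_pow, map_ofNat, evalY_X, ySeries, map_add, map_sub,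
      map_inv₀, map_ofNat, substSq_gen]
    field_simp
    ring
  exact RingHom.congr_fun h Q

/-- The substitution `q ↦ q²` as a ring homomorphism. -/
def expandTwo (R : Type*) [CommRing R] : PowerSeries R →+* PowerSeries R :=
  (PowerSeries.expand 2 two_ne_zero).toRingHom

theorem coeff_expandTwo {R : Type*} [CommRing R] (A : PowerSeries R) (n : ℕ) :
    coeff n (expandTwo R A) = if 2 ∣ n then coeff (n / 2) A else 0 :=
  coeff_expand 2 two_ne_zero A

theorem expandTwo_C {R : Type*} [CommRing R] (r : R) : expandTwo R (C r) = C r :=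
  expand_C 2 two_ne_zero r

/-- The substitution `Y ↦ Y² + 4 Y`, `q ↦ q²`. -/
def polyDoubleSeries : PowerSeries (Polynomial ℚ) →+* PowerSeries (Polynomial ℚ) :=
  (expandTwo (Polynomial ℚ)).comp (PowerSeries.map polyDouble)

theorem doubleVars_evalYSeries (A : PowerSeries (Polynomial ℚ)) :
    doubleVars (evalYSeries A) = evalYSeries (polyDoubleSeries A) := by
  ext1 n
  rw [coeff_doubleVars]
  simp only [evalYSeries, polyDoubleSeries, RingHom.comp_apply, coeff_map, coeff_expandTwo,
    substSq_evalY]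
  split_ifs <;> simp

theorem polyDoubleSeries_constLift (s : PowerSeries ℚ) :
    polyDoubleSeries (constLift s) = constLift (PowerSeries.expand 2 two_ne_zero s) := by
  ext1 n
  simp only [constLift, polyDoubleSeries, RingHom.comp_apply, coeff_map, coeff_expandTwo,
    coeff_expand]
  split_ifs <;> simp [polyDouble]

theorem polyDoubleSeries_C_X :
    polyDoubleSeries (C Polynomial.X) = C Polynomial.X ^ 2 + 4 * C Polynomial.X := by
  rw [polyDoubleSeries, RingHom.comp_apply, map_C, expandTwo_C, polyDouble,
    Polynomial.coe_eval₂RingHom, Polynomial.eval₂_X, map_add, map_mul, map_pow, map_ofNat]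

theorem evenPart_add {R : Type*} [Semiring R] (A B : PowerSeries R) :
    evenPart (A + B) = evenPart A + evenPart B := by
  ext1 n
  simp [evenPart]

theorem evenPart_C_mul {R : Type*} [Semiring R] (r : R) (A : PowerSeries R) :
    evenPart (C r * A) = C r * evenPart A := by
  ext1 n
  rw [evenPart, coeff_mk, coeff_C_mul, coeff_C_mul, evenPart, coeff_mk]

theorem evenPart_C {R : Type*} [Semiring R] (r : R) : evenPart (C r) = C r := by
  ext1 n
  simp [evenPart, coeff_C]

theorem evenPart_map {R S : Type*} [Semiring R] [Semiring S] (f : R →+* S) (A : PowerSeries R) :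
    evenPart (PowerSeries.map f A) = PowerSeries.map f (evenPart A) := by
  ext1 n
  simp [evenPart]

theorem exists_phi_eq : ∃ R, phi = evalYSeries (C Polynomial.X +
    C (Polynomial.X ^ 2) * ((-2) * constLift sigmaSeries) + C (Polynomial.X ^ 3) * R) := by
  obtain ⟨R, hR⟩ := exists_polyProd_eq
  -- The Y² cofactor of (1 - Y S + Y² R)².
  refine ⟨2 * R + constLift sigmaSeries ^ 2 - 2 * C Polynomial.X * constLift sigmaSeries * R
    + C Polynomial.X ^ 2 * R ^ 2, ?_⟩
  rw [phi, ← evalYSeries_polyProd, ← map_pow, ← evalY_X, ← evalYSeries_C, ← map_mul, hR, map_pow,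
    map_pow]
  congr 1
  ring

theorem exists_phi_sq_mul_weierstrassP_eq : ∃ R, 12 * (phi ^ 2 * weierstrassP) =
    evalYSeries (12 * C Polynomial.X + C Polynomial.X ^ 2 * (1 - 48 * constLift sigmaSeries)
      + C (Polynomial.X ^ 3) * R) := by
  obtain ⟨R, hR⟩ := exists_polyProd_eq
  obtain ⟨W, hW⟩ := exists_evalYSeries_eq_ySeries_mul_weierstrassP
  have h1 : 12 * (phi ^ 2 * weierstrassP) =
      evalYSeries (12 * (C Polynomial.X * polyProd ^ 4 *
        (1 + C Polynomial.X * C (Polynomial.C (1 / 12)) + C Polynomial.X ^ 2 * W))) := by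
    rw [map_mul, map_mul _ (_ * _), ← hW, map_mul, map_pow, evalYSeries_polyProd, evalYSeries_C,
      evalY_X, map_ofNat, phi]
    ring
  have he : 12 * (C (Polynomial.C (1 / 12)) : PowerSeries (Polynomial ℚ)) = 1 := by
    rw [← map_ofNat (C (R := Polynomial ℚ)) 12, ← map_mul, ← map_ofNat Polynomial.C 12, ← map_mul]
    norm_num
  rw [h1, hR]
  generalize (C (Polynomial.C (1 / 12)) : PowerSeries (Polynomial ℚ)) = e at *
  generalize constLift sigmaSeries = S at *
  rw [map_pow]
  generalize (C Polynomial.X : PowerSeries (Polynomial ℚ)) = y at *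
  -- The fourth power is expanded as the square of 1 - 2 y S + y² Q, where Q = 2 R + S² - 2 y S R +
  -- y² R². The witness collects what lies beyond y² in 12 y (1 - y S + y² R)⁴ (1 + y e + y² W).
  refine ⟨12 * (W - 4 * S * e - 4 * y * S * W +
    (4 * S ^ 2 + 2 * (2 * R + S ^ 2 - 2 * y * S * R + y ^ 2 * R ^ 2)
      - 4 * y * S * (2 * R + S ^ 2 - 2 * y * S * R + y ^ 2 * R ^ 2)
      + y ^ 2 * (2 * R + S ^ 2 - 2 * y * S * R + y ^ 2 * R ^ 2) ^ 2)
      * (1 + y * e + y ^ 2 * W)), ?_⟩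
  congr 1
  linear_combination y ^ 2 * he

theorem exists_doubleVars_phi_eq : ∃ R, doubleVars phi =
    evalYSeries (4 * C Polynomial.X + C Polynomial.X ^ 2 *
        (1 - 32 * constLift (PowerSeries.expand 2 two_ne_zero sigmaSeries))
      + C (Polynomial.X ^ 3) * R) := by
  obtain ⟨R, hR⟩ := exists_phi_eq
  refine ⟨(-2) * (8 + C Polynomial.X) * constLift (PowerSeries.expand 2 two_ne_zero sigmaSeries)
    + (C Polynomial.X + 4) ^ 3 * polyDoubleSeries R, ?_⟩
  rw [hR, doubleVars_evalYSeries]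
  congr 1
  simp only [map_add, map_mul, map_pow, map_neg, map_ofNat, polyDoubleSeries_C_X,
    polyDoubleSeries_constLift]
  ring

theorem exists_evenPart_phi_eq : ∃ R, evenPart phi =
    evalYSeries (C Polynomial.X + C Polynomial.X ^ 2 * ((-2) * constLift (evenPart sigmaSeries))
      + C (Polynomial.X ^ 3) * R) := by
  obtain ⟨R, hR⟩ := exists_phi_eq
  refine ⟨evenPart R, ?_⟩
  have h2 : (-2 : PowerSeries (Polynomial ℚ)) = C (-2) := by rw [map_neg, map_ofNat]
  rw [hR, evalYSeries, evenPart_map, evenPart_add, evenPart_add, evenPart_C_mul, evenPart_C_mul,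
    h2, evenPart_C_mul, evenPart_C, constLift, evenPart_map, map_pow]

theorem exists_defect_eq : ∃ R, defect = evalYSeries (C (Polynomial.X ^ 3) * R) := by
  obtain ⟨R1, h1⟩ := exists_phi_sq_mul_weierstrassP_eq
  obtain ⟨R2, h2⟩ := exists_doubleVars_phi_eq
  obtain ⟨R3, h3⟩ := exists_evenPart_phi_eq
  refine ⟨R1 - R2 - 8 * R3, ?_⟩
  have hs := congrArg constLift evenPart_sigmaSeries
  simp only [map_add, map_mul, map_ofNat] at hs
  have h8 : (8 : PowerSeries (LaurentSeries ℚ)) = evalYSeries 8 := (map_ofNat _ 8).symm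
  rw [defect, h1, h2, h3, h8, ← map_mul, ← map_sub, ← map_sub]
  congr 1
  -- The Y² coefficient is -48 S + 32 S(q²) + 16 ∑ σ(2d) q^d, sixteen times the Hecke relation.
  linear_combination 16 * C Polynomial.X ^ 2 * hs

/-! ### The identity -/

theorem coeff_phi_neg (n : ℕ) (l : ℤ) : (coeff n phi).coeff (-l) = (coeff n phi).coeff l := by
  obtain ⟨R, hR⟩ := exists_phi_eq
  rw [hR, evalYSeries, coeff_map, evalY_neg_coeff]

/-- The index 1 relation applied twice, with l ↦ -l in between, moves (2n, l) to (2(n + l + 2), -l -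
4): all even rows are permuted among themselves, as index 2 requires. -/
theorem isQuasiPeriodic_evenPart_phi : IsQuasiPeriodic 2 (evenPart phi) := by
  refine ⟨fun n n' l hl => ?_, fun n l hl => ?_⟩
  · rw [evenPart, coeff_mk, coeff_mk]
    -- The intermediate row is 2n + l + 1 = n + n' - 1; if it is negative, both coefficients vanish.
    rcases lt_or_ge ((n : ℤ) + n' - 1) 0 with h0 | h0
    · rw [isQuasiPeriodic_phi.2 _ _ (by omega), isQuasiPeriodic_phi.2 _ _ (by omega)]
    · obtain ⟨k, hk⟩ := Int.eq_ofNat_of_zero_le h0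
      rw [isQuasiPeriodic_phi.1 (2 * n) k l (by push_cast; omega),
        isQuasiPeriodic_phi.1 (2 * n') k _ (by push_cast; omega), ← coeff_phi_neg]
      congr 1
      ring
  · rw [evenPart, coeff_mk]
    rcases lt_or_ge ((2 * n : ℕ) + l + 1) 0 with h0 | h0
    · exact isQuasiPeriodic_phi.2 _ _ h0
    · obtain ⟨k, hk⟩ := Int.eq_ofNat_of_zero_le h0
      rw [isQuasiPeriodic_phi.1 (2 * n) k l hk.symm, ← coeff_phi_neg]
      exact isQuasiPeriodic_phi.2 _ _ (by push_cast at hk; omega)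

theorem isQuasiPeriodic_defect : IsQuasiPeriodic 2 defect :=
  ((isQuasiPeriodic_phi_sq_mul_weierstrassP.natCast_mul 12).sub
    isQuasiPeriodic_doubleVars_phi).sub (isQuasiPeriodic_evenPart_phi.natCast_mul 8)

theorem defect_eq_zero : defect = 0 := by
  obtain ⟨R, hR⟩ := exists_defect_eq
  rw [hR]
  exact eq_zero_of_isQuasiPeriodic (hR ▸ isQuasiPeriodic_defect)

end AbelianThreefold

end

theorem mainTheorem12 :
    (∃! f : ℕ → LaurentSeries ℚ, AbelianThreefold.IsCoeffsOne f) ∧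
    (∃! g : ℕ → LaurentSeries ℚ, AbelianThreefold.IsCoeffsTwo g) ∧
    ∀ f g : ℕ → LaurentSeries ℚ,
      AbelianThreefold.IsCoeffsOne f → AbelianThreefold.IsCoeffsTwo g →
      ∀ d : ℕ,
        (Odd d → g d = f (2 * d)) ∧
        (Even d → g d = f (2 * d) + (1 / 2 : ℚ) • AbelianThreefold.substSq (f (d / 2))) := by
  simp only [AbelianThreefold.isCoeffsOne_iff, AbelianThreefold.isCoeffsTwo_iff]
  refine ⟨AbelianThreefold.existsUnique_mk_eq _, AbelianThreefold.existsUnique_mk_eq _, ?_⟩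
  intro f g hf hg d
  have h := AbelianThreefold.coeff_secondSeries_of_defect AbelianThreefold.defect_eq_zero d
  rw [← hf, ← hg] at h
  simp only [PowerSeries.coeff_mk] at h
  refine ⟨fun hd => ?_, fun hd => ?_⟩
  · rw [h, if_neg (by rw [← even_iff_two_dvd]; exact Nat.not_even_iff_odd.2 hd), add_zero]
  · rw [h, if_pos (even_iff_two_dvd.1 hd)]
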